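/- Let $\Omega\subset\mathbb R^2$ be a bounded simply connected open set with $C^\infty$ boundary $\Sigma=\partial\Omega$, put $\Omega_+=\Omega$, $\Omega_-=\mathbb R^2\setminus\overline\Omega$, let $\mathbf n=(n_1,n_2)$ be the outer unit normal of $\Omega$ on $\Sigma$ and $\mathbf t=(-n_2,n_1)$. Let $\sigma_1,\sigma_2,\sigma_3$ be the Pauli matrices, $\sigma\cdot A=\sigma_1A_1+\sigma_2A_2$, and $D_0=-i\,\sigma\cdot\nabla+m\sigma_3$ with $m\in\mathbb R$. For an open set $V$ let $H(\sigma,V)=\{f\in L^2(V;\mathbb C^2):\sigma\cdot\nabla f\in L^2(V;\mathbb C^2)\}$, and let $\mathcal T_\pm:H(\sigma,\Omega_\pm)\to H^{-1/2}(\Sigma;\mathbb C^2)$ be the Dirichlet trace operators, that is, the unique bounded extensions of the restriction to $\Sigma$ of functions that are smooth up to the boundary. For $\eta,\tau,\lambda,\omega\in C^\infty(\Sigma;\mathbb R)$ let $\mathscr D_{\eta,\tau,\lambda,\omega}$ be the operator in $L^2(\mathbb R^2;\mathbb C^2)$ that acts as $f=f_+\oplus f_-\mapsto D_0f_+\oplus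 D_0f_-$ on the domain of all $f_+\oplus f_-\in H(\sigma,\Omega_+)\oplus H(\sigma,\Omega_-)$ with $$ i(\sigma\cdot\mathbf n)(\mathcal T_-f_--\mathcal T_+f_+)=\tfrac12\big(\eta\,\mathbb I_2+\tau\sigma_3+\lambda(\sigma\cdot\mathbf t)+\omega(\sigma\cdot\mathbf n)\big)(\mathcal T_-f_-+\mathcal T_+f_+)\quad\text{in }H^{-1/2}(\Sigma;\mathbb C^2).$$ **Theorem.** Let $\omega\in\mathbb R$ be a constant and let $\eta,\tau,\lambda\in C^\infty(\Sigma;\mathbb R)$ be such that $d:=\eta^2-\tau^2-\lambda^2$ is constant on $\Sigma$. Let $X\in\mathbb C$ be a solution of $$dX^2-4+(4+\omega^2-d)X=0,$$ and put $$z:=\frac{dX^2+4}{X\,(4+d-\omega^2+4\omega i)}\quad\text{if }(d,\omega)\neq(-4,0),\qquad z:=1\quad\text{if }(d,\omega)=(-4,0).$$ Then $X\in\mathbb R\setminus\{0\}$, $|z|=1$, the operator $$U_z\varphi:=\chi_{\Omega_+}\varphi+z\,\chi_{\Omega_-}\varphi\qquad(\varphi\in L^2(\mathbb R^2;\mathbb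 C^2))$$ is unitary in $L^2(\mathbb R^2;\mathbb C^2)$, and $$\mathscr D_{\eta,\tau,\lambda,\omega}=U_z\,\mathscr D_{X\eta,X\tau,X\lambda,0}\,U_{\overline z},$$ as an equality of unbounded operators, including their domains. -/

import Mathlib

open MeasureTheory Filter Topology Set
open scoped ENNReal NNReal RealInnerProductSpace Distributions

noncomputable section

namespace DiracShell

/-- The Euclidean plane. -/
abbrev Plane := EuclideanSpace ℝ (Fin 2)

/-- `ℂ²` with its Hermitian norm. -/
abbrev Spinor := EuclideanSpace ℂ (Fin 2)

/-- The Hilbert space `L²(ℝ²; ℂ²)`. -/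
abbrev L2 := Lp Spinor 2 (volume : Measure Plane)

section Smoothness

open scoped ContDiff

/-! ### Smooth bounded simply connected domains -/

/-- `ρ` is a smooth local defining function of `Ω` on the open set `U`. -/
structure IsLocalDefining (Ω U : Set Plane) (ρ : Plane → ℝ) : Prop where
  isOpen : IsOpen U
  contDiffOn : ContDiffOn ℝ ∞ ρ U
  mem_iff : ∀ y ∈ U, (y ∈ Ω ↔ ρ y < 0)
  gradient_ne_zero : ∀ y ∈ U, gradient ρ y ≠ 0

/-- A bounded simply connected open set with `C^∞` boundary: near every boundary point it is
the sublevel set of a smooth function without critical points. -/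
structure SmoothDomain where
  carrier : Set Plane
  isOpen : IsOpen carrier
  isBounded : Bornology.IsBounded carrier
  isSimplyConnected : IsSimplyConnected carrier
  smooth_boundary : ∀ x ∈ frontier carrier, ∃ U ρ, x ∈ U ∧ IsLocalDefining carrier U ρ

namespace SmoothDomain

variable (Ω : SmoothDomain)

/-- `Ω₊ = Ω`. -/
def inside : TopologicalSpace.Opens Plane := ⟨Ω.carrier, Ω.isOpen⟩

/-- `Ω₋ = ℝ² \ closure Ω`. -/
def outside : TopologicalSpace.Opens Plane := ⟨(closure Ω.carrier)ᶜ, isClosed_closure.isOpen_compl⟩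

/-- The shell `Σ = ∂Ω`. -/
def shell : Set Plane := frontier Ω.carrier

/-- The outer unit normal of `Ω` at a boundary point: the normalized gradient of a local defining
function (the choice does not matter, see `outerNormal_eq`); `0` off the boundary. -/
def outerNormal (x : Plane) : Plane := by
  classical exact
  if h : ∃ ρ : Plane → ℝ, x ∈ Ω.shell ∧ ∃ U, x ∈ U ∧ IsLocalDefining Ω.carrier U ρ then
    ‖gradient h.choose x‖⁻¹ • gradient h.choose x
  else 0

variable {Ω}

lemma isLocalDefining_hasGradientAt {U : Set Plane} {ρ : Plane → ℝ} {x : Plane}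
    (h : IsLocalDefining Ω.carrier U ρ) (hx : x ∈ U) : HasGradientAt ρ (gradient ρ x) x :=
  (((h.contDiffOn.contDiffAt (h.isOpen.mem_nhds hx)).differentiableAt (by simp))).hasGradientAt

lemma isLocalDefining_eq_zero {U : Set Plane} {ρ : Plane → ℝ} {x : Plane}
    (h : IsLocalDefining Ω.carrier U ρ) (hx : x ∈ U) (hxs : x ∈ Ω.shell) : ρ x = 0 := by
  have h1 : x ∉ Ω.carrier := by
    have := hxs.2
    rwa [Ω.isOpen.interior_eq] at this
  have h2 : 0 ≤ ρ x := not_lt.1 fun hlt => h1 ((h.mem_iff x hx).2 hlt)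
  refine le_antisymm ?_ h2
  have hc : ContinuousAt ρ x :=
    (h.contDiffOn.contDiffAt (h.isOpen.mem_nhds hx)).continuousAt
  by_contra hlt
  push Not at hlt
  have hev : ∀ᶠ y in 𝓝 x, y ∉ Ω.carrier := by
    filter_upwards [hc.eventually (lt_mem_nhds hlt), h.isOpen.mem_nhds hx] with y hy hyU hyΩ
    exact absurd ((h.mem_iff y hyU).1 hyΩ) (not_lt.2 hy.le)
  exact (mem_closure_iff_frequently.1 hxs.1) hev

/-- A direction along which one defining function decreases is not one along which another
one increases. -/
lemma isLocalDefining_inner_le {U V : Set Plane} {ρ ρ' : Plane → ℝ} {x v : Plane}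
    (h : IsLocalDefining Ω.carrier U ρ) (h' : IsLocalDefining Ω.carrier V ρ')
    (hx : x ∈ U) (hx' : x ∈ V) (hxs : x ∈ Ω.shell)
    (hv : ⟪gradient ρ x, v⟫ < 0) : ⟪gradient ρ' x, v⟫ ≤ 0 := by
  have key : ∀ {W : Set Plane} {r : Plane → ℝ}, IsLocalDefining Ω.carrier W r → x ∈ W →
      HasDerivAt (fun t : ℝ => r (x + t • v)) ⟪gradient r x, v⟫ 0 := by
    intro W r hr hxW
    have h1 : HasFDerivAt r (InnerProductSpace.toDual ℝ Plane (gradient r x)) (x + (0 : ℝ) • v) := by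
      simpa using (isLocalDefining_hasGradientAt hr hxW).hasFDerivAt
    have h2 : HasDerivAt (fun t : ℝ => x + t • v) v 0 := by
      simpa using ((hasDerivAt_id (0 : ℝ)).smul_const v).const_add x
    exact (h1.comp_hasDerivAt (0 : ℝ) h2).congr_deriv (InnerProductSpace.toDual_apply_apply ..)
  have hline : Tendsto (fun t : ℝ => x + t • v) (𝓝[>] 0) (𝓝 x) := by
    have : Continuous fun t : ℝ => x + t • v := by fun_prop
    have := this.tendsto 0
    simp only [zero_smul, add_zero] at this
    exact this.mono_left nhdsWithin_le_nhds
  have s1 := (hasDerivAt_iff_tendsto_slope_zero.1 (key h hx)).mono_left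
    (nhdsGT_le_nhdsNE (0 : ℝ))
  have s2 := (hasDerivAt_iff_tendsto_slope_zero.1 (key h' hx')).mono_left
    (nhdsGT_le_nhdsNE (0 : ℝ))
  simp only [zero_add, zero_smul, add_zero, isLocalDefining_eq_zero h hx hxs,
    isLocalDefining_eq_zero h' hx' hxs, sub_zero, smul_eq_mul] at s1 s2
  refine le_of_tendsto s2 ?_
  filter_upwards [s1.eventually (gt_mem_nhds hv), hline.eventually (h.isOpen.mem_nhds hx),
    hline.eventually (h'.isOpen.mem_nhds hx'), self_mem_nhdsWithin] with t ht hU hV ht0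
  have ht0' : (0 : ℝ) < t := ht0
  have hneg : ρ (x + t • v) < 0 := by
    by_contra hcon
    push Not at hcon
    have : 0 ≤ t⁻¹ * ρ (x + t • v) := by positivity
    linarith
  have hin := (h'.mem_iff _ hV).1 ((h.mem_iff _ hU).2 hneg)
  exact mul_nonpos_of_nonneg_of_nonpos (by positivity) hin.le

lemma normalize_gradient_eq {U V : Set Plane} {ρ ρ' : Plane → ℝ} {x : Plane}
    (h : IsLocalDefining Ω.carrier U ρ) (h' : IsLocalDefining Ω.carrier V ρ')
    (hx : x ∈ U) (hx' : x ∈ V) (hxs : x ∈ Ω.shell) :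
    ‖gradient ρ x‖⁻¹ • gradient ρ x = ‖gradient ρ' x‖⁻¹ • gradient ρ' x := by
  have ha := norm_pos_iff.2 (h.gradient_ne_zero x hx)
  have hb := norm_pos_iff.2 (h'.gradient_ne_zero x hx')
  set a := ‖gradient ρ x‖⁻¹ • gradient ρ x with ha_def
  set b := ‖gradient ρ' x‖⁻¹ • gradient ρ' x with hb_def
  have na : ‖a‖ = 1 := by rw [ha_def, norm_smul, norm_inv, norm_norm, inv_mul_cancel₀ ha.ne']
  have nb : ‖b‖ = 1 := by rw [hb_def, norm_smul, norm_inv, norm_norm, inv_mul_cancel₀ hb.ne']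
  by_contra hne
  have hlt : ⟪a, b⟫ < 1 := (inner_lt_one_iff_real_of_norm_eq_one na nb).2 hne
  have e1 : ⟪a, b - a⟫ < 0 := by
    rw [inner_sub_right, real_inner_self_eq_norm_sq, na]; linarith
  have e2 : 0 < ⟪b, b - a⟫ := by
    rw [inner_sub_right, real_inner_self_eq_norm_sq, nb, real_inner_comm]; linarith
  rw [ha_def, real_inner_smul_left] at e1
  rw [hb_def, real_inner_smul_left] at e2
  have e1' : ⟪gradient ρ x, b - a⟫ < 0 := by
    by_contra hcon
    push Not at hcon
    have := mul_nonneg (inv_nonneg.2 ha.le) hcon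
    exact absurd e1 (not_lt.2 this)
  have e3 := isLocalDefining_inner_le h h' hx hx' hxs e1'
  have := mul_nonpos_of_nonneg_of_nonpos (inv_nonneg.2 hb.le) e3
  exact absurd e2 (not_lt.2 this)

lemma outerNormal_eq {U : Set Plane} {ρ : Plane → ℝ} {x : Plane}
    (h : IsLocalDefining Ω.carrier U ρ) (hx : x ∈ U) (hxs : x ∈ Ω.shell) :
    Ω.outerNormal x = ‖gradient ρ x‖⁻¹ • gradient ρ x := by
  have hex : ∃ ρ : Plane → ℝ, x ∈ Ω.shell ∧ ∃ U, x ∈ U ∧ IsLocalDefining Ω.carrier U ρ :=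
    ⟨ρ, hxs, U, hx, h⟩
  obtain ⟨_, V, hxV, hV⟩ := hex.choose_spec
  rw [outerNormal, dif_pos hex]
  exact normalize_gradient_eq hV h hxV hx hxs

lemma norm_outerNormal {x : Plane} (hxs : x ∈ Ω.shell) : ‖Ω.outerNormal x‖ = 1 := by
  obtain ⟨U, ρ, hx, h⟩ := Ω.smooth_boundary x hxs
  rw [outerNormal_eq h hx hxs, norm_smul, norm_inv, norm_norm,
    inv_mul_cancel₀ (norm_pos_iff.2 (h.gradient_ne_zero x hx)).ne']

lemma contDiffOn_outerNormal : ContDiffOn ℝ ∞ Ω.outerNormal Ω.shell := by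
  intro x hxs
  obtain ⟨U, ρ, hx, h⟩ := Ω.smooth_boundary x hxs
  have hg : ContDiffAt ℝ ∞ (gradient ρ) x := by
    have : ContDiffAt ℝ ∞ (fderiv ℝ ρ) x :=
      (h.contDiffOn.contDiffAt (h.isOpen.mem_nhds hx)).fderiv_right (by simp)
    exact (InnerProductSpace.toDual ℝ Plane).symm.toContinuousLinearEquiv.contDiff.contDiffAt.comp
      x this
  have hn : ContDiffAt ℝ ∞ (fun y => ‖gradient ρ y‖⁻¹ • gradient ρ y) x :=
    ((hg.norm ℝ (h.gradient_ne_zero x hx)).inv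
      (norm_pos_iff.2 (h.gradient_ne_zero x hx)).ne').smul hg
  refine hn.contDiffWithinAt.congr_of_eventuallyEq ?_ (outerNormal_eq h hx hxs)
  filter_upwards [self_mem_nhdsWithin, mem_nhdsWithin_of_mem_nhds (h.isOpen.mem_nhds hx)]
    with y hys hyU
  exact outerNormal_eq h hyU hys

lemma isCompact_shell : IsCompact Ω.shell :=
  Metric.isCompact_of_isClosed_isBounded isClosed_frontier
    (Ω.isBounded.closure.subset frontier_subset_closure)

/-- The shell has finite length. -/
lemma hausdorffMeasure_shell_lt_top : Measure.hausdorffMeasure 1 Ω.shell < ⊤ := by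
  refine isCompact_shell.measure_lt_top_of_nhdsWithin fun x hxs => ?_
  obtain ⟨U, ρ, hx, h⟩ := Ω.smooth_boundary x hxs
  set g := gradient ρ x with hg
  have hgpos : 0 < ‖g‖ := norm_pos_iff.2 (h.gradient_ne_zero x hx)
  have hst : HasStrictFDerivAt ρ (InnerProductSpace.toDual ℝ Plane g) x := by
    have h1 := (h.contDiffOn.contDiffAt (h.isOpen.mem_nhds hx)).hasStrictFDerivAt (by simp)
    rwa [(isLocalDefining_hasGradientAt h hx).hasFDerivAt.fderiv] at h1
  have hsmall := hst.isLittleO.def (show (0 : ℝ) < ‖g‖ / 2 by positivity)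
  rw [nhds_prod_eq] at hsmall
  obtain ⟨t, ht, htt⟩ := Filter.mem_prod_self_iff.1 hsmall
  obtain ⟨r, hr, hrt⟩ := Metric.mem_nhds_iff.1 (Filter.inter_mem ht (h.isOpen.mem_nhds hx))
  set s := Metric.ball x r ∩ Ω.shell with hs
  refine ⟨s, inter_mem (mem_nhdsWithin_of_mem_nhds (Metric.ball_mem_nhds x hr))
    self_mem_nhdsWithin, ?_⟩
  let τ : Plane → ℝ := fun y => -(g 1) * y 0 + g 0 * y 1
  have hbound : ∀ y ∈ s, ∀ y' ∈ s, dist y y' ≤ 2 / ‖g‖ * dist (τ y) (τ y') := by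
    intro y hy y' hy'
    have e := htt (mk_mem_prod (hrt hy.1).1 (hrt hy'.1).1)
    simp only [mem_ofPred_eq] at e
    rw [isLocalDefining_eq_zero h (hrt hy.1).2 hy.2,
      isLocalDefining_eq_zero h (hrt hy'.1).2 hy'.2] at e
    simp only [sub_self, zero_sub, norm_neg, InnerProductSpace.toDual_apply_apply] at e
    set v := y - y' with hv
    have hτ : τ y - τ y' = -(g 1) * v 0 + g 0 * v 1 := by
      simp only [τ, hv, PiLp.sub_apply]; ring
    have hin : ⟪g, v⟫ = g 0 * v 0 + g 1 * v 1 := by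
      simp only [PiLp.inner_apply, Fin.sum_univ_two, RCLike.inner_apply, conj_trivial]; ring
    have ng : ‖g‖ ^ 2 = g 0 ^ 2 + g 1 ^ 2 := by
      simp [EuclideanSpace.norm_sq_eq, Fin.sum_univ_two]
    have nv : ‖v‖ ^ 2 = v 0 ^ 2 + v 1 ^ 2 := by
      simp [EuclideanSpace.norm_sq_eq, Fin.sum_univ_two]
    have hsq : ⟪g, v⟫ ^ 2 ≤ (‖g‖ / 2 * ‖v‖) ^ 2 := by
      rw [Real.norm_eq_abs] at e
      rw [← sq_abs]
      exact pow_le_pow_left₀ (abs_nonneg _) e 2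
    have hlag : ⟪g, v⟫ ^ 2 + (τ y - τ y') ^ 2 = (‖g‖ * ‖v‖) ^ 2 := by
      rw [hin, hτ, mul_pow, ng, nv]; ring
    have hle : (‖g‖ / 2 * ‖v‖) ^ 2 ≤ |τ y - τ y'| ^ 2 := by
      rw [sq_abs]; nlinarith [sq_nonneg (‖g‖ * ‖v‖)]
    have := (sq_le_sq₀ (by positivity) (abs_nonneg _)).1 hle
    rw [dist_eq_norm, Real.dist_eq, ← hv]
    calc ‖v‖ = 2 / ‖g‖ * (‖g‖ / 2 * ‖v‖) := by field_simp
      _ ≤ _ := by gcongr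
  have hanti : AntilipschitzWith (2 / ‖g‖).toNNReal (s.domRestrict τ) := by
    refine AntilipschitzWith.of_le_mul_dist fun y y' => ?_
    rw [Real.coe_toNNReal _ (by positivity)]
    exact hbound y y.2 y' y'.2
  have hτc : Continuous τ := by fun_prop
  have h1 := hanti.le_hausdorffMeasure_image zero_le_one univ
  have h2 : Measure.hausdorffMeasure 1 s = Measure.hausdorffMeasure 1 (univ : Set s) := by
    have := (isometry_subtype_coe (s := s)).hausdorffMeasure_image (Or.inl zero_le_one) univ
    rwa [image_univ, Subtype.range_coe] at this
  rw [h2]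
  refine h1.trans_lt (ENNReal.mul_lt_top (by simp) ?_)
  rw [hausdorffMeasure_real]
  have hb : Bornology.IsBounded (τ '' Metric.closedBall x r) :=
    ((isCompact_closedBall x r).image hτc).isBounded
  refine (measure_mono ?_).trans_lt hb.measure_lt_top
  rintro _ ⟨y, -, rfl⟩
  exact ⟨y, Metric.ball_subset_closedBall y.2.1, rfl⟩

/-- The shell is a Lebesgue null set. -/
lemma volume_shell : volume Ω.shell = 0 := by
  have h0 : Measure.hausdorffMeasure (2 : ℝ) Ω.shell = 0 :=
    (Measure.hausdorffMeasure_zero_or_top (show (1 : ℝ) < 2 by norm_num) Ω.shell).resolve_right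
      hausdorffMeasure_shell_lt_top.ne
  have : (volume : Measure Plane) ≪ Measure.hausdorffMeasure (2 : ℝ) := by
    have hinst : (Measure.hausdorffMeasure (2 : ℝ) : Measure Plane).IsAddHaarMeasure := by
      simpa using isAddHaarMeasure_hausdorffMeasure (E := Plane)
    exact Measure.absolutelyContinuous_isAddHaarMeasure _ _
  exact this h0

instance : IsFiniteMeasure (Measure.hausdorffMeasure 1 : Measure Ω.shell) := by
  have h := (isometry_subtype_coe (s := Ω.shell)).hausdorffMeasure_image
    (d := 1) (Or.inl zero_le_one) univ
  rw [image_univ, Subtype.range_coe] at h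
  exact ⟨h ▸ hausdorffMeasure_shell_lt_top⟩

end SmoothDomain

/-! ### Smooth functions and Sobolev spaces on the shell -/

/-- `C^∞(S; 𝕜)`: the functions on `S` that locally extend to smooth functions on the plane. -/
def CInf (𝕜 : Type) [RCLike 𝕜] (S : Set Plane) : Subalgebra 𝕜 (S → 𝕜) where
  carrier := {g | ∃ G : Plane → 𝕜, ContDiffOn ℝ ∞ G S ∧ ∀ x : S, G x = g x}
  mul_mem' := by
    rintro a b ⟨G, hG, hGa⟩ ⟨H, hH, hHb⟩
    exact ⟨fun x => G x * H x, hG.mul hH, fun x => by simp [hGa, hHb]⟩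
  add_mem' := by
    rintro a b ⟨G, hG, hGa⟩ ⟨H, hH, hHb⟩
    exact ⟨fun x => G x + H x, hG.add hH, fun x => by simp [hGa, hHb]⟩
  algebraMap_mem' r := ⟨fun _ => r, contDiffOn_const, fun _ => rfl⟩

/-- A real smooth function seen as a complex one. -/
def complexify {S : Set Plane} (a : CInf ℝ S) : CInf ℂ S :=
  ⟨fun x => ((a : S → ℝ) x : ℂ), by
    obtain ⟨G, hG, hGa⟩ := a.2
    exact ⟨fun x => (G x : ℂ), Complex.ofRealCLM.contDiff.comp_contDiffOn hG,
      fun x => by simp [hGa]⟩⟩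

end Smoothness

/-- The norm of `H^{1/2}(S)` (Sobolev-Slobodeckij), with respect to arc length `μH[1]`. -/
def halfNorm (S : Set Plane) (ψ : S → ℂ) : ℝ≥0∞ :=
  ((∫⁻ x, ‖ψ x‖ₑ ^ 2 ∂(Measure.hausdorffMeasure 1)) +
    ∫⁻ x, ∫⁻ y, ‖ψ x - ψ y‖ₑ ^ 2 / edist x y ^ 2
      ∂(Measure.hausdorffMeasure 1) ∂(Measure.hausdorffMeasure 1)) ^ (1 / 2 : ℝ)

/-- Linear functionals on `C^∞(S)`; those in `HNegHalf S` are distributions. -/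
abbrev Functional (S : Set Plane) := CInf ℂ S →ₗ[ℂ] ℂ

/-- The norm of `H^{-1/2}(S)`: the norm dual to that of `H^{1/2}(S)`. -/
def negHalfNorm {S : Set Plane} (u : Functional S) : ℝ≥0∞ :=
  ⨆ ψ : CInf ℂ S, ‖u ψ‖ₑ / halfNorm S ψ

lemma negHalfNorm_zero {S : Set Plane} : negHalfNorm (0 : Functional S) = 0 := by
  simp [negHalfNorm]

lemma negHalfNorm_add_le {S : Set Plane} (u v : Functional S) :
    negHalfNorm (u + v) ≤ negHalfNorm u + negHalfNorm v := by
  refine iSup_le fun ψ => ?_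
  calc ‖(u + v) ψ‖ₑ / halfNorm S ψ ≤ (‖u ψ‖ₑ + ‖v ψ‖ₑ) / halfNorm S ψ := by
        gcongr; exact enorm_add_le _ _
    _ = ‖u ψ‖ₑ / halfNorm S ψ + ‖v ψ‖ₑ / halfNorm S ψ := ENNReal.add_div
    _ ≤ _ := add_le_add (le_iSup (fun ψ : CInf ℂ S => ‖u ψ‖ₑ / halfNorm S ψ) ψ)
        (le_iSup (fun ψ : CInf ℂ S => ‖v ψ‖ₑ / halfNorm S ψ) ψ)

lemma negHalfNorm_smul_le {S : Set Plane} (c : ℂ) (u : Functional S) :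
    negHalfNorm (c • u) ≤ ‖c‖ₑ * negHalfNorm u := by
  refine iSup_le fun ψ => ?_
  rw [LinearMap.smul_apply, enorm_smul, mul_div_assoc]
  gcongr
  exact le_iSup (fun ψ : CInf ℂ S => ‖u ψ‖ₑ / halfNorm S ψ) ψ

/-- `H^{-1/2}(S)`, the dual of `H^{1/2}(S)`: the functionals on the dense subspace `C^∞(S)` that
are bounded for the norm of `H^{1/2}(S)`. -/
def HNegHalf (S : Set Plane) : Submodule ℂ (Functional S) where
  carrier := {u | negHalfNorm u < ⊤}
  zero_mem' := by simp [negHalfNorm_zero]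
  add_mem' hu hv := (negHalfNorm_add_le _ _).trans_lt (ENNReal.add_lt_top.2 ⟨hu, hv⟩)
  smul_mem' c _ hu := (negHalfNorm_smul_le c _).trans_lt (ENNReal.mul_lt_top enorm_lt_top hu)

/-- The action of a matrix of smooth functions on a pair of distributions:
`(M T)_i = ∑ j, M_ij T_j` with `(a T)(ψ) = T(aψ)`. -/
def matAct {S : Set Plane} (M : Matrix (Fin 2) (Fin 2) (CInf ℂ S)) (T : Fin 2 → Functional S) :
    Fin 2 → Functional S :=
  fun i => ∑ j, (T j).comp (LinearMap.mulLeft ℂ (M i j))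

lemma matAct_zero {S : Set Plane} (M : Matrix (Fin 2) (Fin 2) (CInf ℂ S)) : matAct M 0 = 0 := by
  ext i ψ
  simp [matAct]

lemma matAct_add {S : Set Plane} (M : Matrix (Fin 2) (Fin 2) (CInf ℂ S))
    (T T' : Fin 2 → Functional S) : matAct M (T + T') = matAct M T + matAct M T' := by
  ext i ψ
  simp only [matAct, Pi.add_apply, LinearMap.add_comp, Finset.sum_add_distrib]

lemma matAct_smul {S : Set Plane} (M : Matrix (Fin 2) (Fin 2) (CInf ℂ S)) (c : ℂ)
    (T : Fin 2 → Functional S) : matAct M (c • T) = c • matAct M T := by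
  ext i ψ
  simp [matAct]

/-! ### Pauli matrices -/

def pauli₁ : Matrix (Fin 2) (Fin 2) ℂ := !![0, 1; 1, 0]

def pauli₂ : Matrix (Fin 2) (Fin 2) ℂ := !![0, -Complex.I; Complex.I, 0]

def pauli₃ : Matrix (Fin 2) (Fin 2) ℂ := !![1, 0; 0, -1]

/-- The linear map of `ℂ²` given by a matrix. -/
def act (M : Matrix (Fin 2) (Fin 2) ℂ) : Spinor →L[ℂ] Spinor := Matrix.toEuclideanCLM (𝕜 := ℂ) M

/-- A constant matrix seen as a matrix of smooth functions on `S`. -/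
def constMat (S : Set Plane) (M : Matrix (Fin 2) (Fin 2) ℂ) : Matrix (Fin 2) (Fin 2) (CInf ℂ S) :=
  M.map (algebraMap ℂ (CInf ℂ S))

/-- `σ·A = A₁σ₁ + A₂σ₂` for a smooth vector field `A` on `S`. -/
def sigmaDot {S : Set Plane} (A : Fin 2 → CInf ℝ S) : Matrix (Fin 2) (Fin 2) (CInf ℂ S) :=
  complexify (A 0) • constMat S pauli₁ + complexify (A 1) • constMat S pauli₂

/-- `σ·∇f = σ₁∂₁f + σ₂∂₂f` for a differentiable `f`. -/
def sigmaGrad (f : Plane → Spinor) (x : Plane) : Spinor :=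
  act pauli₁ (fderiv ℝ f x (EuclideanSpace.single 0 1)) +
    act pauli₂ (fderiv ℝ f x (EuclideanSpace.single 1 1))

lemma sigmaGrad_add {V : TopologicalSpace.Opens Plane} (φ φ' : 𝓓(V, Spinor)) (x : Plane) :
    sigmaGrad (φ + φ') x = sigmaGrad φ x + sigmaGrad φ' x := by
  have h1 : DifferentiableAt ℝ φ x := (φ.contDiff.differentiable (by simp)) x
  have h2 : DifferentiableAt ℝ φ' x := (φ'.contDiff.differentiable (by simp)) x
  simp only [sigmaGrad, fderiv_add h1 h2, add_apply, map_add]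
  abel

lemma sigmaGrad_smul {V : TopologicalSpace.Opens Plane} (c : ℂ) (φ : 𝓓(V, Spinor)) (x : Plane) :
    sigmaGrad (c • φ) x = c • sigmaGrad φ x := by
  have h1 : DifferentiableAt ℝ φ x := (φ.contDiff.differentiable (by simp)) x
  have h2 : fderiv ℝ (c • ⇑φ) x = c • fderiv ℝ φ x := fderiv_const_smul h1 c
  simp only [sigmaGrad, h2, smul_apply, map_smul, smul_add]

lemma continuous_sigmaGrad {V : TopologicalSpace.Opens Plane} (φ : 𝓓(V, Spinor)) :
    Continuous (sigmaGrad φ) := by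
  have h : ∀ v : Plane, Continuous fun x => fderiv ℝ φ x v := fun v =>
    (φ.contDiff.continuous_fderiv (by simp)).clm_apply continuous_const
  exact ((act pauli₁).continuous.comp (h _)).add ((act pauli₂).continuous.comp (h _))

/-- `σ·∇f = g` on `V` in the sense of distributions. Thus `f` restricted to `V` belongs to
`H(σ, V)` when this holds for some `g` in `L²`. -/
def HasSigmaGrad (V : TopologicalSpace.Opens Plane) (f g : L2) : Prop :=
  ∀ φ : 𝓓(V, ℂ), ∫ x, φ x • g x =
    -∫ x, (fderiv ℝ φ x (EuclideanSpace.single 0 1) • act pauli₁ (f x) +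
      fderiv ℝ φ x (EuclideanSpace.single 1 1) • act pauli₂ (f x))

lemma integrable_smul_L2 (a : Plane → ℂ) (ha : Continuous a) (hc : HasCompactSupport a)
    (f : Plane → Spinor) (hf : MemLp f 2 volume) : Integrable (fun x => a x • f x) := by
  have ha2 : MemLp a 2 (volume : Measure Plane) := ha.memLp_of_hasCompactSupport hc
  have := hf.smul (r := 1) ha2
  exact memLp_one_iff_integrable.1 this

lemma integrable_testFunction_smul {V : TopologicalSpace.Opens Plane} (φ : 𝓓(V, ℂ)) (g : L2) :
    Integrable (fun x => φ x • g x) :=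
  integrable_smul_L2 _ φ.continuous φ.hasCompactSupport _ (Lp.memLp g)

lemma integrable_fderiv_smul {V : TopologicalSpace.Opens Plane} (φ : 𝓓(V, ℂ)) (v : Plane)
    (A : Spinor →L[ℂ] Spinor) (f : L2) :
    Integrable (fun x => fderiv ℝ φ x v • A (f x)) := by
  refine integrable_smul_L2 _ ?_ ?_ _ (A.comp_memLp' (Lp.memLp f))
  · exact (φ.contDiff.continuous_fderiv (by simp)).clm_apply continuous_const
  · exact φ.hasCompactSupport.fderiv_apply (𝕜 := ℝ) v

lemma HasSigmaGrad.add {V : TopologicalSpace.Opens Plane} {f g f' g' : L2}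
    (h : HasSigmaGrad V f g) (h' : HasSigmaGrad V f' g') :
    HasSigmaGrad V (f + f') (g + g') := by
  intro φ
  have i1 : Integrable (fun x => fderiv ℝ φ x (EuclideanSpace.single 0 1) • act pauli₁ (f x) +
      fderiv ℝ φ x (EuclideanSpace.single 1 1) • act pauli₂ (f x)) :=
    (integrable_fderiv_smul φ _ _ f).add (integrable_fderiv_smul φ _ _ f)
  have i2 : Integrable (fun x => fderiv ℝ φ x (EuclideanSpace.single 0 1) • act pauli₁ (f' x) +
      fderiv ℝ φ x (EuclideanSpace.single 1 1) • act pauli₂ (f' x)) :=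
    (integrable_fderiv_smul φ _ _ f').add (integrable_fderiv_smul φ _ _ f')
  have e1 : ∫ x, φ x • (g + g') x = ∫ x, (φ x • g x + φ x • g' x) :=
    integral_congr_ae (by
      filter_upwards [Lp.coeFn_add g g'] with x hx
      rw [hx, Pi.add_apply, smul_add])
  rw [e1, integral_add (integrable_testFunction_smul φ g) (integrable_testFunction_smul φ g'),
    h φ, h' φ, ← neg_add, ← integral_add i1 i2]
  congr 1
  refine integral_congr_ae ?_
  filter_upwards [Lp.coeFn_add f f'] with x hx
  rw [hx, Pi.add_apply, map_add, map_add, smul_add, smul_add]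
  abel

lemma HasSigmaGrad.smul {V : TopologicalSpace.Opens Plane} {f g : L2} (c : ℂ)
    (h : HasSigmaGrad V f g) : HasSigmaGrad V (c • f) (c • g) := by
  intro φ
  have e1 : ∫ x, φ x • (c • g) x = ∫ x, c • (φ x • g x) :=
    integral_congr_ae (by
      filter_upwards [Lp.coeFn_smul c g] with x hx
      rw [hx, Pi.smul_apply, smul_comm])
  rw [e1, integral_smul, h φ, smul_neg, ← integral_smul]
  congr 1
  refine integral_congr_ae ?_
  filter_upwards [Lp.coeFn_smul c f] with x hx
  rw [hx, Pi.smul_apply, map_smul, map_smul, smul_add, smul_comm c, smul_comm c]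

lemma hasSigmaGrad_zero (V : TopologicalSpace.Opens Plane) : HasSigmaGrad V 0 0 := by
  intro φ
  have e1 : ∫ x, φ x • (0 : L2) x = ∫ _ : Plane, (0 : Spinor) :=
    integral_congr_ae (by
      filter_upwards [Lp.coeFn_zero Spinor 2 (volume : Measure Plane)] with x hx
      rw [hx]; simp)
  have e2 : ∫ x, (fderiv ℝ φ x (EuclideanSpace.single 0 1) • act pauli₁ ((0 : L2) x) +
      fderiv ℝ φ x (EuclideanSpace.single 1 1) • act pauli₂ ((0 : L2) x)) =
      ∫ _ : Plane, (0 : Spinor) :=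
    integral_congr_ae (by
      filter_upwards [Lp.coeFn_zero Spinor 2 (volume : Measure Plane)] with x hx
      rw [hx]; simp)
  rw [e1, e2]; simp

/-- The distributional `σ·∇f` is unique on `V`. -/
lemma HasSigmaGrad.ae_eq_zero {V : TopologicalSpace.Opens Plane} {g : L2}
    (h : HasSigmaGrad V 0 g) : ∀ᵐ x, x ∈ V → g x = 0 := by
  refine V.isOpen.ae_eq_zero_of_integral_contDiff_smul_eq_zero
    (((Lp.memLp g).locallyIntegrable (by norm_num)).locallyIntegrableOn _) ?_
  intro a ha hc hs
  have hsupp : tsupport (fun x => (a x : ℂ)) = tsupport a := by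
    unfold tsupport
    congr 1
    ext x
    simp
  let φ : 𝓓(V, ℂ) := ⟨fun x => (a x : ℂ), Complex.ofRealCLM.contDiff.comp ha,
    by rw [HasCompactSupport, hsupp]; exact hc, by rw [hsupp]; exact hs⟩
  have h1 := h φ
  have e2 : ∫ x, (fderiv ℝ φ x (EuclideanSpace.single 0 1) • act pauli₁ ((0 : L2) x) +
      fderiv ℝ φ x (EuclideanSpace.single 1 1) • act pauli₂ ((0 : L2) x)) =
      ∫ _ : Plane, (0 : Spinor) :=
    integral_congr_ae (by
      filter_upwards [Lp.coeFn_zero Spinor 2 (volume : Measure Plane)] with x hx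
      rw [hx]; simp)
  rw [e2, integral_zero, neg_zero] at h1
  rw [← h1]
  refine integral_congr_ae (Eventually.of_forall fun x => ?_)
  exact (Complex.coe_smul (a x) (g x)).symm

namespace SmoothDomain

variable (Ω : SmoothDomain)

/-- The components of the outer unit normal `n`. -/
def normal (j : Fin 2) : CInf ℝ Ω.shell :=
  ⟨fun x => Ω.outerNormal x j, fun x => Ω.outerNormal x j,
    (contDiffOn_euclidean.1 contDiffOn_outerNormal) j, fun _ => rfl⟩

/-- The components of the unit tangent `t = (-n₂, n₁)`. -/
def tangent : Fin 2 → CInf ℝ Ω.shell := ![-Ω.normal 1, Ω.normal 0]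

/-- The Hermitian matrix `η I + τ σ₃ + λ (σ·t) + ω (σ·n)` on the shell. -/
def shellMatrix (η τ lam ω : CInf ℝ Ω.shell) : Matrix (Fin 2) (Fin 2) (CInf ℂ Ω.shell) :=
  complexify η • 1 + complexify τ • constMat Ω.shell pauli₃ +
    complexify lam • sigmaDot Ω.tangent + complexify ω • sigmaDot Ω.normal

lemma integrable_mul (a : C(Plane, ℂ)) (ψ : CInf ℂ Ω.shell) :
    Integrable (fun x : Ω.shell => a x * (ψ : Ω.shell → ℂ) x) (Measure.hausdorffMeasure 1) := by
  have : CompactSpace Ω.shell := isCompact_iff_compactSpace.1 isCompact_shell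
  have hψ : Continuous (ψ : Ω.shell → ℂ) := by
    obtain ⟨G, hG, hGψ⟩ := ψ.2
    refine hG.continuousOn.domRestrict.congr fun x => ?_
    simp [hGψ]
  exact ((a.continuous.comp continuous_subtype_val).mul hψ).integrable_of_hasCompactSupport
    (HasCompactSupport.of_compactSpace _)

/-- A continuous function `a` on the plane, restricted to the shell and seen as the functional
`ψ ↦ ∫_Σ a ψ ds` on `C^∞(Σ)`. -/
def shellFunctional (a : C(Plane, ℂ)) : Functional Ω.shell where
  toFun ψ := ∫ x : Ω.shell, a x * (ψ : Ω.shell → ℂ) x ∂(Measure.hausdorffMeasure 1)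
  map_add' ψ ψ' := by
    rw [← integral_add (Ω.integrable_mul a ψ) (Ω.integrable_mul a ψ')]
    simp [mul_add]
  map_smul' c ψ := by
    rw [RingHom.id_apply, ← integral_smul]
    congr 1
    ext x
    simp [mul_left_comm]

lemma shellFunctional_add (a b : C(Plane, ℂ)) :
    Ω.shellFunctional (a + b) = Ω.shellFunctional a + Ω.shellFunctional b := by
  ext ψ
  change ∫ x : Ω.shell, (a + b) x * (ψ : Ω.shell → ℂ) x ∂(Measure.hausdorffMeasure 1) =
    (∫ x : Ω.shell, a x * (ψ : Ω.shell → ℂ) x ∂(Measure.hausdorffMeasure 1)) +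
      ∫ x : Ω.shell, b x * (ψ : Ω.shell → ℂ) x ∂(Measure.hausdorffMeasure 1)
  rw [← integral_add (Ω.integrable_mul a ψ) (Ω.integrable_mul b ψ)]
  simp [add_mul]

lemma shellFunctional_smul (c : ℂ) (a : C(Plane, ℂ)) :
    Ω.shellFunctional (c • a) = c • Ω.shellFunctional a := by
  ext ψ
  change ∫ x : Ω.shell, (c • a) x * (ψ : Ω.shell → ℂ) x ∂(Measure.hausdorffMeasure 1) =
    c • ∫ x : Ω.shell, a x * (ψ : Ω.shell → ℂ) x ∂(Measure.hausdorffMeasure 1)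
  rw [← integral_smul]
  simp [mul_assoc]

/-- `T` is the Dirichlet trace of `f|_V` on the shell, for `V = Ω₊` or `V = Ω₋`: the trace operator
`H(σ, V) → H^{-1/2}(Σ; ℂ²)` is the unique bounded extension of the classical restriction
`φ ↦ φ|_Σ` of functions that are smooth up to the boundary, so its graph is the closure of the
graph of this restriction. -/
def HasTrace (V : TopologicalSpace.Opens Plane) (f : L2) (T : Fin 2 → Functional Ω.shell) : Prop :=
  (∀ j, T j ∈ HNegHalf Ω.shell) ∧
  ∃ g : L2, HasSigmaGrad V f g ∧ ∃ φ : ℕ → 𝓓((⊤ : TopologicalSpace.Opens Plane), Spinor),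
    Tendsto (fun k => eLpNorm (fun x => φ k x - f x) 2 (volume.restrict V)) atTop (𝓝 0) ∧
    Tendsto (fun k => eLpNorm (fun x => sigmaGrad (φ k) x - g x) 2 (volume.restrict V))
      atTop (𝓝 0) ∧
    ∀ j, Tendsto (fun k => negHalfNorm
      (Ω.shellFunctional ⟨fun x => φ k x j, by fun_prop⟩ - T j)) atTop (𝓝 0)

variable {Ω} in
lemma HasTrace.add {V : TopologicalSpace.Opens Plane} {f f' : L2} {T T' : Fin 2 → Functional Ω.shell}
    (h : Ω.HasTrace V f T) (h' : Ω.HasTrace V f' T') : Ω.HasTrace V (f + f') (T + T') := by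
  obtain ⟨hT, g, hg, φ, h1, h2, h3⟩ := h
  obtain ⟨hT', g', hg', φ', h1', h2', h3'⟩ := h'
  refine ⟨fun j => add_mem (hT j) (hT' j), g + g', hg.add hg', fun k => φ k + φ' k, ?_, ?_, ?_⟩
  · have := h1.add h1'
    rw [add_zero] at this
    refine tendsto_of_tendsto_of_tendsto_of_le_of_le tendsto_const_nhds this (fun _ => zero_le)
      fun k => ?_
    refine le_trans (le_of_eq ?_) (eLpNorm_add_le ?_ ?_ (by norm_num))
    · refine eLpNorm_congr_ae (ae_restrict_of_ae ?_)
      filter_upwards [Lp.coeFn_add f f'] with x hx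
      simp only [hx, Pi.add_apply, FunLike.coe_add]
      abel
    · exact (((φ k).continuous.aestronglyMeasurable).sub (Lp.aestronglyMeasurable f)).restrict
    · exact (((φ' k).continuous.aestronglyMeasurable).sub (Lp.aestronglyMeasurable f')).restrict
  · have := h2.add h2'
    rw [add_zero] at this
    refine tendsto_of_tendsto_of_tendsto_of_le_of_le tendsto_const_nhds this (fun _ => zero_le)
      fun k => ?_
    refine le_trans (le_of_eq ?_) (eLpNorm_add_le ?_ ?_ (by norm_num))
    · refine eLpNorm_congr_ae (ae_restrict_of_ae ?_)
      filter_upwards [Lp.coeFn_add g g'] with x hx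
      simp only [hx, Pi.add_apply, FunLike.coe_add, sigmaGrad_add]
      abel
    · exact (((continuous_sigmaGrad (φ k)).aestronglyMeasurable).sub
        (Lp.aestronglyMeasurable g)).restrict
    · exact (((continuous_sigmaGrad (φ' k)).aestronglyMeasurable).sub
        (Lp.aestronglyMeasurable g')).restrict
  · intro j
    have := (h3 j).add (h3' j)
    rw [add_zero] at this
    refine tendsto_of_tendsto_of_tendsto_of_le_of_le tendsto_const_nhds this (fun _ => zero_le)
      fun k => ?_
    refine le_trans (le_of_eq ?_) (negHalfNorm_add_le _ _)
    congr 1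
    have e : (⟨fun x => (φ k + φ' k) x j, by fun_prop⟩ : C(Plane, ℂ)) =
        ⟨fun x => φ k x j, by fun_prop⟩ + ⟨fun x => φ' k x j, by fun_prop⟩ := by
      ext x; simp
    rw [e, shellFunctional_add, Pi.add_apply]
    abel

variable {Ω} in
lemma HasTrace.smul {V : TopologicalSpace.Opens Plane} {f : L2} {T : Fin 2 → Functional Ω.shell}
    (c : ℂ) (h : Ω.HasTrace V f T) : Ω.HasTrace V (c • f) (c • T) := by
  obtain ⟨hT, g, hg, φ, h1, h2, h3⟩ := h
  refine ⟨fun j => Submodule.smul_mem _ c (hT j), c • g, hg.smul c, fun k => c • φ k, ?_, ?_, ?_⟩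
  · have := ENNReal.Tendsto.const_mul (a := ‖c‖ₑ) h1 (Or.inr enorm_ne_top)
    rw [mul_zero] at this
    refine this.congr fun k => ?_
    rw [← eLpNorm_const_smul]
    refine eLpNorm_congr_ae (ae_restrict_of_ae ?_)
    filter_upwards [Lp.coeFn_smul c f] with x hx
    simp [hx, smul_sub]
  · have := ENNReal.Tendsto.const_mul (a := ‖c‖ₑ) h2 (Or.inr enorm_ne_top)
    rw [mul_zero] at this
    refine this.congr fun k => ?_
    rw [← eLpNorm_const_smul]
    refine eLpNorm_congr_ae (ae_restrict_of_ae ?_)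
    filter_upwards [Lp.coeFn_smul c g] with x hx
    simp [hx, smul_sub, sigmaGrad_smul]
  · intro j
    have := ENNReal.Tendsto.const_mul (a := ‖c‖ₑ) (h3 j) (Or.inr enorm_ne_top)
    rw [mul_zero] at this
    refine tendsto_of_tendsto_of_tendsto_of_le_of_le tendsto_const_nhds this (fun _ => zero_le)
      fun k => ?_
    refine le_trans (le_of_eq ?_) (negHalfNorm_smul_le _ _)
    congr 1
    have e : (⟨fun x => (c • φ k) x j, by fun_prop⟩ : C(Plane, ℂ)) =
        c • ⟨fun x => φ k x j, by fun_prop⟩ := by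
      ext x; simp
    rw [e, shellFunctional_smul, Pi.smul_apply, smul_sub]

lemma hasTrace_zero (V : TopologicalSpace.Opens Plane) : Ω.HasTrace V 0 0 := by
  refine ⟨fun j => zero_mem _, 0, hasSigmaGrad_zero V, fun _ => 0, ?_, ?_, ?_⟩
  · refine tendsto_const_nhds.congr fun k => ?_
    rw [← eLpNorm_zero (ε := Spinor) (p := 2) (μ := volume.restrict (V : Set Plane))]
    refine eLpNorm_congr_ae (ae_restrict_of_ae ?_)
    exact Eventually.of_forall fun x => by simp
  · refine tendsto_const_nhds.congr fun k => ?_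
    rw [← eLpNorm_zero (ε := Spinor) (p := 2) (μ := volume.restrict (V : Set Plane))]
    refine eLpNorm_congr_ae (ae_restrict_of_ae ?_)
    exact Eventually.of_forall fun x => by simp [sigmaGrad]
  · intro j
    refine tendsto_const_nhds.congr fun k => ?_
    rw [← negHalfNorm_zero (S := Ω.shell)]
    congr 1
    have e : (⟨fun x => (0 : 𝓓((⊤ : TopologicalSpace.Opens Plane), Spinor)) x j,
        by fun_prop⟩ : C(Plane, ℂ)) = (0 : ℂ) • 0 := by
      ext x; simp
    rw [e, shellFunctional_smul]
    simp

/-- The transmission condition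
`i (σ·n) (T₋ f - T₊ f) = ½ (η I + τ σ₃ + λ (σ·t) + ω (σ·n)) (T₋ f + T₊ f)` in `H^{-1/2}(Σ; ℂ²)`
for the Dirichlet traces `T₊ f` and `T₋ f` of `f` from `Ω₊` and `Ω₋`. -/
def TransmissionCondition (η τ lam ω : CInf ℝ Ω.shell) (f : L2) : Prop :=
  ∃ Tp Tm : Fin 2 → Functional Ω.shell,
    Ω.HasTrace Ω.inside f Tp ∧ Ω.HasTrace Ω.outside f Tm ∧
    Complex.I • matAct (sigmaDot Ω.normal) (Tm - Tp) =
      (1 / 2 : ℂ) • matAct (Ω.shellMatrix η τ lam ω) (Tm + Tp)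

/-- The graph of the Dirac operator with `δ`-shell interaction: the pairs `(f, D₀f₊ ⊕ D₀f₋)` with
`f₊ ⊕ f₋ ∈ H(σ, Ω₊) ⊕ H(σ, Ω₋)` subject to the transmission condition. Here `g` is
`σ·∇f₊ ⊕ σ·∇f₋` and `D₀ = -i σ·∇ + m σ₃`. -/
def diracGraph (m : ℝ) (η τ lam ω : CInf ℝ Ω.shell) : Submodule ℂ (L2 × L2) where
  carrier := {p | (∃ g : L2, HasSigmaGrad Ω.inside p.1 g ∧ HasSigmaGrad Ω.outside p.1 g ∧
      p.2 = -Complex.I • g + (m : ℂ) • (act pauli₃).compLpL 2 volume p.1) ∧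
    Ω.TransmissionCondition η τ lam ω p.1}
  zero_mem' := ⟨⟨0, hasSigmaGrad_zero _, hasSigmaGrad_zero _, by simp⟩,
    0, 0, Ω.hasTrace_zero _, Ω.hasTrace_zero _, by simp [matAct_zero]⟩
  add_mem' := by
    rintro p q ⟨⟨g, h1, h2, h3⟩, Tp, Tm, h4, h5, h6⟩ ⟨⟨g', h1', h2', h3'⟩, Tp', Tm', h4', h5', h6'⟩
    refine ⟨⟨g + g', h1.add h1', h2.add h2', ?_⟩, Tp + Tp', Tm + Tm', h4.add h4', h5.add h5', ?_⟩
    · rw [Prod.snd_add, Prod.fst_add, h3, h3', map_add, smul_add, smul_add]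
      abel
    · rw [add_sub_add_comm, matAct_add, smul_add, h6, h6', ← smul_add, ← matAct_add,
        add_add_add_comm]
  smul_mem' := by
    rintro c p ⟨⟨g, h1, h2, h3⟩, Tp, Tm, h4, h5, h6⟩
    refine ⟨⟨c • g, h1.smul c, h2.smul c, ?_⟩, c • Tp, c • Tm, h4.smul c, h5.smul c, ?_⟩
    · rw [Prod.smul_snd, Prod.smul_fst, h3, map_smul, smul_add, smul_comm c, smul_comm c]
    · rw [← smul_sub, ← smul_add, matAct_smul, matAct_smul, smul_comm, h6, smul_comm]

/-- The graph is single-valued. -/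
lemma diracGraph_single_valued (m : ℝ) (η τ lam ω : CInf ℝ Ω.shell) :
    ∀ p ∈ Ω.diracGraph m η τ lam ω, p.1 = 0 → p.2 = 0 := by
  rintro ⟨f, h⟩ ⟨⟨g, h1, h2, h3⟩, -⟩ hf
  simp only at hf h1 h2 h3 ⊢
  subst hf
  have hg : g = 0 := by
    refine Lp.ext ?_
    filter_upwards [h1.ae_eq_zero, h2.ae_eq_zero,
      measure_eq_zero_iff_ae_notMem.1 Ω.volume_shell,
      Lp.coeFn_zero Spinor 2 (volume : Measure Plane)] with x hx1 hx2 hx3 hx4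
    rw [hx4, Pi.zero_apply]
    by_cases hc : x ∈ closure Ω.carrier
    · refine hx1 ?_
      by_contra hcon
      exact hx3 ⟨hc, fun hi => hcon (interior_subset hi)⟩
    · exact hx2 hc
  rw [h3, hg]
  simp

/-- The Dirac operator `D_{η,τ,λ,ω}` in `L²(ℝ²; ℂ²)` with mass `m`. -/
def dirac (m : ℝ) (η τ lam ω : CInf ℝ Ω.shell) : L2 →ₗ.[ℂ] L2 :=
  (Ω.diracGraph m η τ lam ω).toLinearPMap

lemma dirac_graph (m : ℝ) (η τ lam ω : CInf ℝ Ω.shell) :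
    (Ω.dirac m η τ lam ω).graph = Ω.diracGraph m η τ lam ω :=
  Submodule.toLinearPMap_graph_eq _ (Ω.diracGraph_single_valued m η τ lam ω)

end SmoothDomain

/-! ### The gauge transformation -/

lemma memLp_indicator (V : TopologicalSpace.Opens Plane) (f : L2) :
    MemLp ((V : Set Plane).indicator (f : Plane → Spinor)) 2 volume :=
  (Lp.memLp f).indicator V.isOpen.measurableSet

/-- Multiplication by the characteristic function of an open set, as a linear map. -/
def chiLinear (V : TopologicalSpace.Opens Plane) : L2 →ₗ[ℂ] L2 where
  toFun f := (memLp_indicator V f).toLp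
  map_add' f f' := by
    rw [← MemLp.toLp_add]
    refine MemLp.toLp_congr _ _ ?_
    filter_upwards [Lp.coeFn_add f f'] with x hx
    by_cases h : x ∈ (V : Set Plane)
    · simp only [indicator_of_mem h, hx, Pi.add_apply]
    · simp only [indicator_of_notMem h, Pi.add_apply, add_zero]
  map_smul' c f := by
    rw [RingHom.id_apply, ← MemLp.toLp_const_smul]
    refine MemLp.toLp_congr _ _ ?_
    filter_upwards [Lp.coeFn_smul c f] with x hx
    by_cases h : x ∈ (V : Set Plane)
    · simp only [indicator_of_mem h, hx, Pi.smul_apply]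
    · simp only [indicator_of_notMem h, Pi.smul_apply, smul_zero]

lemma chiLinear_apply (V : TopologicalSpace.Opens Plane) (f : L2) :
    chiLinear V f = (memLp_indicator V f).toLp := rfl

lemma coeFn_chiLinear (V : TopologicalSpace.Opens Plane) (f : L2) :
    (chiLinear V f : Plane → Spinor) =ᵐ[volume]
      (V : Set Plane).indicator (f : Plane → Spinor) := by
  rw [chiLinear_apply]
  exact MemLp.coeFn_toLp (memLp_indicator V f)

/-- Multiplication by the characteristic function of an open set, on `L²(ℝ²; ℂ²)`. -/
def chi (V : TopologicalSpace.Opens Plane) : L2 →L[ℂ] L2 :=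
  (chiLinear V).mkContinuous 1 fun f => by
    rw [one_mul]
    refine Lp.norm_le_norm_of_ae_le ?_
    filter_upwards [coeFn_chiLinear V f] with x hx
    rw [hx]
    exact norm_indicator_le_norm_self _ _

/-- `U_z φ = χ_{Ω₊} φ + z χ_{Ω₋} φ`. -/
def SmoothDomain.gauge (Ω : SmoothDomain) (z : ℂ) : L2 →L[ℂ] L2 :=
  chi Ω.inside + z • chi Ω.outside

/-- The composition `U T V` of a partially defined operator `T` with bounded operators, on its
natural domain `{f | V f ∈ dom T}`. -/
def sandwich (U : L2 →L[ℂ] L2) (T : L2 →ₗ.[ℂ] L2) (V : L2 →L[ℂ] L2) : L2 →ₗ.[ℂ] L2 where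
  domain := T.domain.comap V.toLinearMap
  toFun := U.toLinearMap ∘ₗ T.toFun ∘ₗ
    V.toLinearMap.restrict (p := T.domain.comap V.toLinearMap) (q := T.domain) fun _ h => h

/-- The phase `z`; the quotient is `0/0` exactly when `(d, ω) = (-4, 0)`, where `z = 1`. -/
def gaugePhase (d ω : ℝ) (X : ℂ) : ℂ := by
  classical exact
  if d = -4 ∧ ω = 0 then 1
  else (d * X ^ 2 + 4) / (X * (4 + d - ω ^ 2 + 4 * ω * Complex.I))

end DiracShell

end

open DiracShell

/-!
The gauge transformation `U_w` multiplies by a constant on either side of the shell, so it commutes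
with `D₀` there. A function `f` and its image `U_w f` thus have the same trace
`Tp` from inside, and the trace `Tm` from outside gets multiplied by `w`. So the equality of the
operators reduces to an equivalence of two linear relations between `Tp` and `Tm`.

Write `N = σ·n` and `B = η + τ σ₃ + λ σ·t`. Then `N² = 1`, and as `N` anticommutes with `σ₃` and
`σ·t`, the matrix `M = N B` satisfies `M² = η² - τ² - λ² = d`. Multiplied by `N`, the two relations
become
`(i - ω/2 - M/2) Tm = (i + ω/2 + M/2) Tp` and `(i - X M/2) w Tm = (i + X M/2) Tp`,
whose coefficients lie in the commutative algebra `ℂ[M]`, a quotient of `ℂ[T]/(T² - d)` since `d`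
is constant. For `w` the conjugate of the phase `z`, the second relation is the first one times
`p + q M` with `p = (w + 1)/2` and `q = -i (1 - w) X/4`; this is what the quadratic equation for `X`
says (`conj_gaugePhase_relations`). The factor is invertible because its norm `p² - d q²` is not
zero: it divides the norm `-(d X² + 4)/4` of `i + X M/2`, which vanishes only in the exceptional
case `(d, ω) = (-4, 0)`, and there the factor is `1` (`factor_norm_ne_zero`).

The quadratic polynomial has discriminant `(4 + d - ω²)² + 16 ω²`, so that `X` is real; moreover
`(d X² + 4)/X` is the derivative `2 d X + 4 + ω² - d` of the polynomial at its root, whose square is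
the discriminant, and this gives `|z| = 1` (`norm_gaugePhase`).
-/

open MeasureTheory Filter Topology Set
open scoped ENNReal NNReal RealInnerProductSpace Distributions ComplexConjugate

noncomputable section

namespace DiracShell

/-! ### The scalar equation for `X` and the phase -/

/-- The roots are real because the discriminant is `(4 + d - ω²)² + 16 ω² ≥ 0`. When `d = 0` the
equation is linear with the positive leading coefficient `4 + ω²`. -/
lemma exists_real_of_quadratic {ω d : ℝ} {X : ℂ}
    (hX : (d : ℂ) * X ^ 2 - 4 + (4 + (ω : ℂ) ^ 2 - d) * X = 0) :
    ∃ x : ℝ, x ≠ 0 ∧ X = (x : ℂ) ∧ d * x ^ 2 - 4 + (4 + ω ^ 2 - d) * x = 0 := by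
  have hre := congrArg Complex.re hX
  have him := congrArg Complex.im hX
  simp [pow_two] at hre him
  have hy : X.im = 0 := by
    by_contra hy
    have h1 : 2 * d * X.re + (4 + ω ^ 2 - d) = 0 := by
      apply mul_right_cancel₀ hy
      linear_combination him
    have h2 : (4 + d - ω ^ 2) ^ 2 + 16 * ω ^ 2 + (2 * d * X.im) ^ 2 = 0 := by
      linear_combination (2 * d * X.re + (4 + ω ^ 2 - d)) * h1 - 4 * d * hre
    have h3 : 2 * d * X.im = 0 := by
      have := sq_nonneg (4 + d - ω ^ 2)
      have := sq_nonneg ω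
      have := sq_nonneg (2 * d * X.im)
      exact pow_eq_zero_iff two_ne_zero |>.1 (by linarith)
    have hd : d = 0 := by simpa [hy] using h3
    subst hd
    nlinarith [sq_nonneg ω]
  have hXx : X = (X.re : ℂ) := Complex.ext rfl (by simp [hy])
  have hq : d * X.re ^ 2 - 4 + (4 + ω ^ 2 - d) * X.re = 0 := by
    rw [hy] at hre
    linear_combination hre
  refine ⟨X.re, fun h0 => ?_, hXx, hq⟩
  rw [h0] at hq
  norm_num at hq

section Scalars

variable {ω d x : ℝ}

lemma gaugePhase_denom_ne_zero (hx0 : x ≠ 0) (h : ¬(d = -4 ∧ ω = 0)) :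
    (x : ℂ) * (4 + d - ω ^ 2 + 4 * ω * Complex.I) ≠ 0 := by
  refine mul_ne_zero (by exact_mod_cast hx0) fun h0 => h ?_
  have hre := congrArg Complex.re h0
  have him := congrArg Complex.im h0
  simp [pow_two] at hre him
  subst him
  exact ⟨by linarith, rfl⟩

/-- The numerator of the phase is `x` times the derivative of the quadratic polynomial at its root,
and the square of that derivative is the discriminant. -/
lemma sq_gaugePhase_num (hq : d * x ^ 2 - 4 + (4 + ω ^ 2 - d) * x = 0) :
    (d * x ^ 2 + 4) ^ 2 = x ^ 2 * ((4 + d - ω ^ 2) ^ 2 + 16 * ω ^ 2) := by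
  linear_combination (d * x ^ 2 - 4 - (4 + ω ^ 2 - d) * x) * hq

lemma norm_gaugePhase (hx0 : x ≠ 0) (hq : d * x ^ 2 - 4 + (4 + ω ^ 2 - d) * x = 0) :
    ‖gaugePhase d ω x‖ = 1 := by
  unfold gaugePhase
  split_ifs with h
  · simp
  have hD := gaugePhase_denom_ne_zero hx0 h
  rw [norm_div, div_eq_one_iff_eq (norm_ne_zero_iff.2 hD)]
  refine (sq_eq_sq₀ (norm_nonneg _) (norm_nonneg _)).1 ?_
  rw [Complex.sq_norm, Complex.sq_norm, Complex.normSq_apply, Complex.normSq_apply]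
  simp [pow_two]
  linear_combination sq_gaugePhase_num hq

/-- The two scalar equations that express `(p + q M) (i + ω/2 + M/2) = i + x M/2` for `M² = d`,
`p = (w + 1)/2`, `q = -i (1 - w) x/4`, where `w` is the conjugate phase. -/
lemma conj_gaugePhase_relations (hx0 : x ≠ 0)
    (hq : d * x ^ 2 - 4 + (4 + ω ^ 2 - d) * x = 0) :
    (conj (gaugePhase d ω x) + 1) * (Complex.I + ω / 2) -
        Complex.I * (1 - conj (gaugePhase d ω x)) * x * d / 4 = 2 * Complex.I ∧
      conj (gaugePhase d ω x) + 1 -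
        Complex.I * (1 - conj (gaugePhase d ω x)) * x * (Complex.I + ω / 2) = 2 * x := by
  have hqc : (d : ℂ) * x ^ 2 - 4 + (4 + ω ^ 2 - d) * x = 0 := by exact_mod_cast hq
  by_cases h : d = -4 ∧ ω = 0
  · obtain ⟨rfl, rfl⟩ := h
    -- the quadratic equation becomes `(x - 1)² = 0`
    have hx1 : x = 1 := by
      have : (x - 1) ^ 2 = 0 := by linear_combination (-1 / 4) * hq
      have := pow_eq_zero_iff two_ne_zero |>.1 this
      linarith
    subst hx1
    simp [gaugePhase]
    norm_num
  · have hD := (map_ne_zero (starRingEnd ℂ)).2 (gaugePhase_denom_ne_zero hx0 h)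
    have h4 : conj (4 : ℂ) = 4 := map_ofNat _ 4
    have hw : conj (gaugePhase d ω x) *
        conj ((x : ℂ) * (4 + d - ω ^ 2 + 4 * ω * Complex.I)) = d * x ^ 2 + 4 := by
      rw [gaugePhase, if_neg h, ← map_mul, div_mul_cancel₀ _ (gaugePhase_denom_ne_zero hx0 h)]
      simp [h4]
    simp only [map_mul, map_add, map_sub, map_pow, Complex.conj_ofReal, Complex.conj_I, h4]
      at hw hD
    generalize conj (gaugePhase d ω x) = w at hw ⊢
    constructor
    · apply mul_right_cancel₀ hD
      linear_combination (Complex.I + ω / 2 + Complex.I * x * d / 4) * hw +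
        (Complex.I * d / 4 * x - (Complex.I + ω / 2)) * hqc +
        4 * ω * x * (1 + x * d / 4) * Complex.I_sq
    · apply mul_right_cancel₀ hD
      linear_combination (1 + Complex.I * x * (Complex.I + ω / 2)) * hw +
        ((-1 + Complex.I * ω / 2) * x - 1) * hqc +
        ((d * x ^ 2 + 4) * x - x * (x * (4 + d - ω ^ 2 - 4 * ω * Complex.I)) +
          2 * ω ^ 2 * x ^ 2) * Complex.I_sq

lemma gaugePhase_num_ne_zero (hx0 : x ≠ 0) (h : ¬(d = -4 ∧ ω = 0))
    (hq : d * x ^ 2 - 4 + (4 + ω ^ 2 - d) * x = 0) : d * x ^ 2 + 4 ≠ 0 := by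
  intro h0
  have h1 := norm_gaugePhase hx0 hq
  have h2 : (d : ℂ) * (x : ℂ) ^ 2 + 4 = 0 := by exact_mod_cast h0
  rw [gaugePhase, if_neg h, h2] at h1
  simp at h1

/-- The factor `p + q M` of `conj_gaugePhase_relations` is invertible: its norm
`p² - d q²` does not vanish. -/
lemma factor_norm_ne_zero (hx0 : x ≠ 0) (hq : d * x ^ 2 - 4 + (4 + ω ^ 2 - d) * x = 0) :
    ((conj (gaugePhase d ω x) + 1) / 2) ^ 2 -
      d * (-Complex.I * (1 - conj (gaugePhase d ω x)) * x / 4) ^ 2 ≠ 0 := by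
  by_cases h : d = -4 ∧ ω = 0
  · simp [gaugePhase, h]
  · obtain ⟨h1, h2⟩ := conj_gaugePhase_relations hx0 hq
    generalize conj (gaugePhase d ω x) = w at h1 h2 ⊢
    intro h0
    have h3 : (d : ℂ) * x ^ 2 + 4 = 0 := by
      have e1 : (w + 1) / 2 * (Complex.I + ω / 2) +
          (-Complex.I * (1 - w) * x / 4) * d / 2 = Complex.I := by
        linear_combination h1 / 2
      have e2 : (w + 1) / 2 / 2 + (-Complex.I * (1 - w) * x / 4) * (Complex.I + ω / 2) =
          x / 2 := by
        linear_combination h2 / 4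
      generalize (w + 1) / 2 = p at *
      generalize -Complex.I * (1 - w) * x / 4 = q at *
      -- multiplicativity of the norm `p² - d q²` on `ℂ[M]/(M² - d)`
      linear_combination -4 * ((Complex.I + ω / 2) ^ 2 - d / 4) * h0 + 4 * Complex.I_sq +
        4 * (p * (Complex.I + ω / 2) + q * d / 2 + Complex.I) * e1 -
        4 * d * (p / 2 + q * (Complex.I + ω / 2) + x / 2) * e2
    exact gaugePhase_num_ne_zero hx0 h hq (by exact_mod_cast h3)

end Scalars

/-! ### Equivalence of the two transmission relations -/

/-- With `M = N B`, so that `M² = d`, multiplication by `N` turns the relations into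
`e₁ = (i - ω/2 - M/2) Tm - (i + ω/2 + M/2) Tp = 0` and
`e₂ = (i - x M/2) w Tm - (i + x M/2) Tp = 0`, and `e₂ = (p + q M) e₁` with an invertible factor. -/
lemma transmission_iff {E : Type*} [AddCommGroup E] [Module ℂ E] (N B : E →ₗ[ℂ] E)
    {ω d x : ℝ} (hx0 : x ≠ 0) (hq : d * x ^ 2 - 4 + (4 + ω ^ 2 - d) * x = 0)
    (hN : ∀ T, N (N T) = T) (hM : ∀ T, N (B (N (B T))) = (d : ℂ) • T) (Tp Tm : E) :
    (Complex.I • N (Tm - Tp) = (1 / 2 : ℂ) • (B (Tm + Tp) + (ω : ℂ) • N (Tm + Tp))) ↔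
      (Complex.I • N (conj (gaugePhase d ω x) • Tm - Tp) =
        (1 / 2 : ℂ) • (x : ℂ) • B (conj (gaugePhase d ω x) • Tm + Tp)) := by
  obtain ⟨h1, h2⟩ := conj_gaugePhase_relations hx0 hq
  have h3 := factor_norm_ne_zero hx0 hq
  generalize conj (gaugePhase d ω x) = w at h1 h2 h3 ⊢
  set p : ℂ := (w + 1) / 2 with hp
  set q : ℂ := -Complex.I * (1 - w) * x / 4 with hqd
  set e₁ : E := Complex.I • (Tm - Tp) -
    (1 / 2 : ℂ) • (N (B (Tm + Tp)) + (ω : ℂ) • (Tm + Tp)) with he₁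
  set e₂ : E := Complex.I • (w • Tm - Tp) - (1 / 2 : ℂ) • (x : ℂ) • N (B (w • Tm + Tp)) with he₂
  have hinj : ∀ {a b : E}, a = b ↔ N a - N b = 0 := fun {a b} =>
    ⟨fun h => by rw [h, sub_self], fun h => by rw [← hN a, ← hN b, sub_eq_zero.1 h]⟩
  have k1 : (Complex.I • N (Tm - Tp) = (1 / 2 : ℂ) • (B (Tm + Tp) + (ω : ℂ) • N (Tm + Tp))) ↔
      e₁ = 0 := by
    rw [hinj, map_smul, map_smul, hN, map_add, map_smul, hN]
  have k2 : (Complex.I • N (w • Tm - Tp) = (1 / 2 : ℂ) • (x : ℂ) • B (w • Tm + Tp)) ↔ e₂ = 0 := by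
    rw [hinj, map_smul, map_smul, hN, map_smul]
  have hI := Complex.I_sq
  have h21 : e₂ = p • e₁ + q • N (B e₁) := by
    simp only [he₁, he₂, hp, hqd, map_add, map_sub, map_smul, hM]
    match_scalars
    · linear_combination h1 / 2
    · linear_combination h1 / 2
    · linear_combination h2 / 4 + (1 - w) * x / 2 * hI
    · linear_combination h2 / 4
  have h12 : (p ^ 2 - d * q ^ 2) • e₁ = p • e₂ - q • N (B e₂) := by
    rw [h21]
    simp only [map_add, map_smul, hM]
    module
  rw [k1, k2]
  refine ⟨fun h => by rw [h21, h]; simp, fun h => ?_⟩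
  rw [h] at h12
  simpa [h3] using h12

/-! ### The matrices on the shell and their action -/

section MatrixAction

variable {S : Set Plane}

lemma matAct_mul (M M' : Matrix (Fin 2) (Fin 2) (CInf ℂ S)) (T : Fin 2 → Functional S) :
    matAct (M * M') T = matAct M (matAct M' T) := by
  ext i ψ
  simp [matAct, Matrix.mul_apply, Fin.sum_univ_two, add_mul, mul_assoc, mul_left_comm]
  ring

lemma matAct_matrix_add (M M' : Matrix (Fin 2) (Fin 2) (CInf ℂ S)) (T : Fin 2 → Functional S) :
    matAct (M + M') T = matAct M T + matAct M' T := by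
  ext i ψ
  simp [matAct, Fin.sum_univ_two, add_mul]
  ring

lemma matAct_matrix_smul (c : ℂ) (M : Matrix (Fin 2) (Fin 2) (CInf ℂ S))
    (T : Fin 2 → Functional S) : matAct (c • M) T = c • matAct M T := by
  ext i ψ
  simp [matAct, Fin.sum_univ_two]

lemma matAct_one (T : Fin 2 → Functional S) :
    matAct (1 : Matrix (Fin 2) (Fin 2) (CInf ℂ S)) T = T := by
  ext i ψ
  simp only [matAct, Matrix.one_apply, Fin.sum_univ_two]
  fin_cases i <;> simp

/-- The action `T ↦ M T` of a fixed matrix of smooth functions on pairs of distributions, as a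
linear map. -/
def matActLinear (M : Matrix (Fin 2) (Fin 2) (CInf ℂ S)) :
    (Fin 2 → Functional S) →ₗ[ℂ] (Fin 2 → Functional S) where
  toFun := matAct M
  map_add' := matAct_add M
  map_smul' := matAct_smul M

lemma coe_complexify (a : CInf ℝ S) (x : S) :
    (complexify a : S → ℂ) x = (((a : S → ℝ) x : ℝ) : ℂ) := rfl

end MatrixAction

namespace SmoothDomain

variable {Ω : SmoothDomain}

lemma normal_sq_add_sq (x : Ω.shell) :
    (Ω.normal 0 : Ω.shell → ℝ) x ^ 2 + (Ω.normal 1 : Ω.shell → ℝ) x ^ 2 = 1 := by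
  have h := norm_outerNormal x.2
  have h2 := EuclideanSpace.norm_sq_eq (Ω.outerNormal x)
  simp [h, Fin.sum_univ_two] at h2
  exact h2.symm

lemma sigmaDot_normal_mul_self : sigmaDot Ω.normal * sigmaDot Ω.normal = 1 := by
  ext i j x
  have h : ((Ω.normal 0 : Ω.shell → ℝ) x : ℂ) ^ 2 + ((Ω.normal 1 : Ω.shell → ℝ) x : ℂ) ^ 2 = 1 := by
    exact_mod_cast normal_sq_add_sq x
  have hI := Complex.I_sq
  fin_cases i <;> fin_cases j <;>
    simp [sigmaDot, constMat, pauli₁, pauli₂, Matrix.mul_apply, Fin.sum_univ_two, coe_complexify]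
  · linear_combination h - ((Ω.normal 1 : Ω.shell → ℝ) x : ℂ) ^ 2 * hI
  · linear_combination h - ((Ω.normal 1 : Ω.shell → ℝ) x : ℂ) ^ 2 * hI

/-- `σ·n` commutes with `I` and anticommutes with `σ₃` and `σ·t`. -/
lemma sigmaDot_normal_mul_shellMatrix (η τ lam : CInf ℝ Ω.shell) :
    sigmaDot Ω.normal * Ω.shellMatrix η τ lam 0 =
      Ω.shellMatrix η (-τ) (-lam) 0 * sigmaDot Ω.normal := by
  ext i j x
  have hI := Complex.I_sq
  fin_cases i <;> fin_cases j <;>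
    simp [shellMatrix, tangent, sigmaDot, constMat, pauli₁, pauli₂, pauli₃, Matrix.mul_apply,
      Fin.sum_univ_two, coe_complexify]
  · linear_combination (-2) * ((lam : Ω.shell → ℝ) x : ℂ) * ((Ω.normal 0 : Ω.shell → ℝ) x : ℂ) *
      ((Ω.normal 1 : Ω.shell → ℝ) x : ℂ) * hI
  · ring
  · ring
  · linear_combination (-2) * ((lam : Ω.shell → ℝ) x : ℂ) * ((Ω.normal 0 : Ω.shell → ℝ) x : ℂ) *
      ((Ω.normal 1 : Ω.shell → ℝ) x : ℂ) * hI

/-- `(η - τ σ₃ - λ σ·t) (η + τ σ₃ + λ σ·t) = η² - τ² - λ²`, as `σ₃` and `σ·t` anticommute. -/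
lemma shellMatrix_neg_mul {η τ lam : CInf ℝ Ω.shell} {d : ℝ}
    (hd : η ^ 2 - τ ^ 2 - lam ^ 2 = algebraMap ℝ (CInf ℝ Ω.shell) d) :
    Ω.shellMatrix η (-τ) (-lam) 0 * Ω.shellMatrix η τ lam 0 = (d : ℂ) • 1 := by
  ext i j x
  have hn : ((Ω.normal 0 : Ω.shell → ℝ) x : ℂ) ^ 2 + ((Ω.normal 1 : Ω.shell → ℝ) x : ℂ) ^ 2 = 1 := by
    exact_mod_cast normal_sq_add_sq x
  have h : ((η : Ω.shell → ℝ) x : ℂ) ^ 2 - ((τ : Ω.shell → ℝ) x : ℂ) ^ 2 -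
      ((lam : Ω.shell → ℝ) x : ℂ) ^ 2 = d := by
    have := congrArg (fun a : CInf ℝ Ω.shell => (a : Ω.shell → ℝ) x) hd
    simp at this
    exact_mod_cast this
  have hI := Complex.I_sq
  fin_cases i <;> fin_cases j <;>
    simp [shellMatrix, tangent, sigmaDot, constMat, pauli₁, pauli₂, pauli₃, Matrix.mul_apply,
      Fin.sum_univ_two, coe_complexify]
  · linear_combination h - ((lam : Ω.shell → ℝ) x : ℂ) ^ 2 * hn +
      ((lam : Ω.shell → ℝ) x : ℂ) ^ 2 * ((Ω.normal 0 : Ω.shell → ℝ) x : ℂ) ^ 2 * hI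
  · ring
  · ring
  · linear_combination h - ((lam : Ω.shell → ℝ) x : ℂ) ^ 2 * hn +
      ((lam : Ω.shell → ℝ) x : ℂ) ^ 2 * ((Ω.normal 0 : Ω.shell → ℝ) x : ℂ) ^ 2 * hI

lemma shellMatrix_const (η τ lam : CInf ℝ Ω.shell) (ω : ℝ) :
    Ω.shellMatrix η τ lam (algebraMap ℝ (CInf ℝ Ω.shell) ω) =
      Ω.shellMatrix η τ lam 0 + (ω : ℂ) • sigmaDot Ω.normal := by
  ext i j x
  fin_cases i <;> fin_cases j <;> simp [shellMatrix, sigmaDot, constMat, coe_complexify]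

lemma shellMatrix_smul (η τ lam : CInf ℝ Ω.shell) (x : ℝ) :
    Ω.shellMatrix (x • η) (x • τ) (x • lam) 0 = (x : ℂ) • Ω.shellMatrix η τ lam 0 := by
  ext i j y
  fin_cases i <;> fin_cases j <;> simp [shellMatrix, sigmaDot, constMat, coe_complexify] <;> ring

/-- The relation between the traces `Tp`, `Tm` in `D_{η,τ,λ,ω}` is that between `Tp`, `w Tm`
in `D_{xη,xτ,xλ,0}`, with `w` the conjugate phase. -/
lemma trace_relation_iff {η τ lam : CInf ℝ Ω.shell} {ω d x : ℝ}
    (hd : η ^ 2 - τ ^ 2 - lam ^ 2 = algebraMap ℝ (CInf ℝ Ω.shell) d) (hx0 : x ≠ 0)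
    (hq : d * x ^ 2 - 4 + (4 + ω ^ 2 - d) * x = 0) (Tp Tm : Fin 2 → Functional Ω.shell) :
    (Complex.I • matAct (sigmaDot Ω.normal) (Tm - Tp) = (1 / 2 : ℂ) •
        matAct (Ω.shellMatrix η τ lam (algebraMap ℝ (CInf ℝ Ω.shell) ω)) (Tm + Tp)) ↔
      (Complex.I • matAct (sigmaDot Ω.normal) (conj (gaugePhase d ω x) • Tm - Tp) = (1 / 2 : ℂ) •
        matAct (Ω.shellMatrix (x • η) (x • τ) (x • lam) 0)
          (conj (gaugePhase d ω x) • Tm + Tp)) := by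
  rw [shellMatrix_const, shellMatrix_smul]
  simp only [matAct_matrix_add, matAct_matrix_smul]
  refine transmission_iff (matActLinear (sigmaDot Ω.normal))
    (matActLinear (Ω.shellMatrix η τ lam 0)) hx0 hq (fun T => ?_) (fun T => ?_) Tp Tm
  · change matAct _ (matAct _ T) = T
    rw [← matAct_mul, sigmaDot_normal_mul_self, matAct_one]
  · change matAct _ (matAct _ (matAct _ (matAct _ T))) = _
    rw [← matAct_mul, sigmaDot_normal_mul_shellMatrix, matAct_mul, ← matAct_mul (sigmaDot _),
      sigmaDot_normal_mul_self, matAct_one, ← matAct_mul, shellMatrix_neg_mul hd,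
      matAct_matrix_smul, matAct_one]

end SmoothDomain

/-! ### Locality of the distributional derivative and of the traces -/

lemma HasSigmaGrad.congr {V : TopologicalSpace.Opens Plane} {f g f' g' : L2}
    (h : HasSigmaGrad V f g) (hf : f' =ᵐ[volume.restrict V] f) (hg : g' =ᵐ[volume.restrict V] g) :
    HasSigmaGrad V f' g' := by
  intro φ
  rw [Filter.EventuallyEq, ae_restrict_iff' V.isOpen.measurableSet] at hf hg
  have hφ : ∀ x ∉ (V : Set Plane), φ x = 0 ∧ fderiv ℝ φ x = 0 := by
    intro x hx
    have hx' : x ∉ tsupport φ := fun h => hx (φ.tsupport_subset h)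
    exact ⟨image_eq_zero_of_notMem_tsupport hx',
      image_eq_zero_of_notMem_tsupport fun h => hx' (tsupport_fderiv_subset ℝ h)⟩
  have e1 : ∫ x, φ x • g' x = ∫ x, φ x • g x := by
    refine integral_congr_ae ?_
    filter_upwards [hg] with x hx
    by_cases hxV : x ∈ (V : Set Plane)
    · simp only [hx hxV]
    · simp [(hφ x hxV).1]
  rw [e1, h φ]
  congr 1
  refine integral_congr_ae ?_
  filter_upwards [hf] with x hx
  by_cases hxV : x ∈ (V : Set Plane)
  · simp only [hx hxV]
  · simp [(hφ x hxV).2]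

lemma SmoothDomain.HasTrace.congr {Ω : SmoothDomain} {V : TopologicalSpace.Opens Plane} {f f' : L2}
    {T : Fin 2 → Functional Ω.shell} (h : Ω.HasTrace V f T) (hf : f' =ᵐ[volume.restrict V] f) :
    Ω.HasTrace V f' T := by
  obtain ⟨hT, g, hg, φ, h1, h2, h3⟩ := h
  refine ⟨hT, g, hg.congr hf .rfl, φ, h1.congr fun k => eLpNorm_congr_ae ?_, h2, h3⟩
  filter_upwards [hf] with x hx
  rw [hx]

/-! ### The gauge transformation -/

namespace SmoothDomain

variable {Ω : SmoothDomain}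

lemma inside_disjoint_outside {x : Plane} (h : x ∈ (Ω.inside : Set Plane)) :
    x ∉ (Ω.outside : Set Plane) := fun h' => h' (subset_closure h)

lemma ae_inside_or_outside :
    ∀ᵐ x : Plane, x ∈ (Ω.inside : Set Plane) ∨ x ∈ (Ω.outside : Set Plane) := by
  filter_upwards [measure_eq_zero_iff_ae_notMem.1 Ω.volume_shell] with x hx
  by_cases hc : x ∈ closure Ω.carrier
  · refine Or.inl ?_
    by_contra hcon
    exact hx ⟨hc, fun hi => hcon (interior_subset hi)⟩
  · exact Or.inr hc

lemma coeFn_gauge (z : ℂ) (f : L2) :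
    ∀ᵐ x, (x ∈ (Ω.inside : Set Plane) → Ω.gauge z f x = f x) ∧
      (x ∈ (Ω.outside : Set Plane) → Ω.gauge z f x = z • f x) := by
  have e : Ω.gauge z f = chiLinear Ω.inside f + z • chiLinear Ω.outside f := rfl
  rw [e]
  filter_upwards [Lp.coeFn_add (chiLinear Ω.inside f) (z • chiLinear Ω.outside f),
    Lp.coeFn_smul z (chiLinear Ω.outside f), coeFn_chiLinear Ω.inside f,
    coeFn_chiLinear Ω.outside f] with x h1 h2 h3 h4
  rw [h1, Pi.add_apply, h2, Pi.smul_apply, h3, h4]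
  refine ⟨fun hx => ?_, fun hx => ?_⟩
  · rw [indicator_of_mem hx, indicator_of_notMem (inside_disjoint_outside hx)]
    simp
  · rw [indicator_of_mem hx, indicator_of_notMem fun h => inside_disjoint_outside h hx]
    simp

lemma gauge_inside (z : ℂ) (f : L2) :
    Ω.gauge z f =ᵐ[volume.restrict (Ω.inside : Set Plane)] f := by
  rw [Filter.EventuallyEq, ae_restrict_iff' Ω.inside.isOpen.measurableSet]
  filter_upwards [coeFn_gauge z f] with x hx using hx.1

lemma gauge_outside (z : ℂ) (f : L2) :
    Ω.gauge z f =ᵐ[volume.restrict (Ω.outside : Set Plane)] (z • f : L2) := by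
  rw [Filter.EventuallyEq, ae_restrict_iff' Ω.outside.isOpen.measurableSet]
  filter_upwards [coeFn_gauge z f, Lp.coeFn_smul z f] with x hx hz hxo
  rw [hx.2 hxo, hz, Pi.smul_apply]

lemma ext_inside_outside {f g : L2} (h1 : f =ᵐ[volume.restrict (Ω.inside : Set Plane)] g)
    (h2 : f =ᵐ[volume.restrict (Ω.outside : Set Plane)] g) : f = g := by
  rw [Filter.EventuallyEq, ae_restrict_iff' (TopologicalSpace.Opens.isOpen _).measurableSet] at h1 h2
  refine Lp.ext ?_
  filter_upwards [h1, h2, Ω.ae_inside_or_outside] with x h1 h2 hx using hx.elim h1 h2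

lemma gauge_gauge {z w : ℂ} (h : z * w = 1) (f : L2) : Ω.gauge z (Ω.gauge w f) = f := by
  refine ext_inside_outside (Ω := Ω) ((gauge_inside z _).trans (gauge_inside w f)) ?_
  have hm := Ω.outside.isOpen.measurableSet
  rw [Filter.EventuallyEq, ae_restrict_iff' hm]
  filter_upwards [coeFn_gauge (Ω := Ω) z (Ω.gauge w f), coeFn_gauge (Ω := Ω) w f] with x h1 h2 hx
  rw [h1.2 hx, h2.2 hx, smul_smul, h, one_smul]

lemma norm_gauge {z : ℂ} (hz : ‖z‖ = 1) (f : L2) : ‖Ω.gauge z f‖ = ‖f‖ := by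
  rw [Lp.norm_def, Lp.norm_def]
  congr 1
  refine eLpNorm_congr_norm_ae ?_
  filter_upwards [coeFn_gauge (Ω := Ω) z f, Ω.ae_inside_or_outside] with x h1 hx
  rcases hx with hx | hx
  · rw [h1.1 hx]
  · rw [h1.2 hx, norm_smul, hz, one_mul]

lemma mul_conj_of_norm_eq_one {z : ℂ} (hz : ‖z‖ = 1) : z * conj z = 1 := by
  rw [Complex.mul_conj', hz]; simp

lemma gauge_mem_unitary {z : ℂ} (hz : ‖z‖ = 1) : Ω.gauge z ∈ unitary (L2 →L[ℂ] L2) := by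
  have h1 : ContinuousLinearMap.adjoint (Ω.gauge z) ∘L Ω.gauge z = 1 :=
    (ContinuousLinearMap.norm_map_iff_adjoint_comp_self (Ω.gauge z)).1 (norm_gauge hz)
  have h2 : Ω.gauge z ∘L Ω.gauge (conj z) = 1 := by
    refine ContinuousLinearMap.ext fun f => ?_
    rw [ContinuousLinearMap.comp_apply, gauge_gauge (mul_conj_of_norm_eq_one hz),
      one_apply_eq_self]
  have h3 : ContinuousLinearMap.adjoint (Ω.gauge z) = Ω.gauge (conj z) :=
    left_inv_eq_right_inv (M := L2 →L[ℂ] L2) h1 h2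
  rw [unitary, Submonoid.mem_mk]
  refine ⟨h1, ?_⟩
  rw [ContinuousLinearMap.star_eq_adjoint, h3]
  exact h2

lemma HasTrace.gauge_inside {f : L2} {T : Fin 2 → Functional Ω.shell} (w : ℂ)
    (h : Ω.HasTrace Ω.inside f T) : Ω.HasTrace Ω.inside (Ω.gauge w f) T :=
  h.congr (SmoothDomain.gauge_inside w f)

lemma HasTrace.gauge_outside {f : L2} {T : Fin 2 → Functional Ω.shell} (w : ℂ)
    (h : Ω.HasTrace Ω.outside f T) : Ω.HasTrace Ω.outside (Ω.gauge w f) (w • T) :=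
  (h.smul w).congr (SmoothDomain.gauge_outside w f)

lemma gauge_compLpL (w : ℂ) (A : Spinor →L[ℂ] Spinor) (f : L2) :
    Ω.gauge w (A.compLpL 2 volume f) = A.compLpL 2 volume (Ω.gauge w f) := by
  refine Lp.ext ?_
  filter_upwards [coeFn_gauge (Ω := Ω) w f, coeFn_gauge (Ω := Ω) w (A.compLpL 2 volume f),
    A.coeFn_compLpL (p := 2) (μ := volume) f, A.coeFn_compLpL (p := 2) (μ := volume) (Ω.gauge w f),
    Ω.ae_inside_or_outside] with x h1 h2 h3 h4 hx
  rcases hx with hx | hx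
  · rw [h2.1 hx, h3, h4, h1.1 hx]
  · rw [h2.2 hx, h3, h4, h1.2 hx, map_smul]

/-- The gauge transformation maps the graph of one operator into that of another one, provided the
relations between the traces correspond to each other. -/
lemma gauge_mem_diracGraph {m : ℝ} {η τ lam ω η' τ' lam' ω' : CInf ℝ Ω.shell} {w : ℂ}
    (hT : ∀ Tp Tm : Fin 2 → Functional Ω.shell,
      Complex.I • matAct (sigmaDot Ω.normal) (Tm - Tp) =
          (1 / 2 : ℂ) • matAct (Ω.shellMatrix η τ lam ω) (Tm + Tp) →
        Complex.I • matAct (sigmaDot Ω.normal) (w • Tm - Tp) =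
          (1 / 2 : ℂ) • matAct (Ω.shellMatrix η' τ' lam' ω') (w • Tm + Tp))
    {p : L2 × L2} (hp : p ∈ Ω.diracGraph m η τ lam ω) :
    (Ω.gauge w p.1, Ω.gauge w p.2) ∈ Ω.diracGraph m η' τ' lam' ω' := by
  obtain ⟨⟨g, h1, h2, h3⟩, Tp, Tm, h4, h5, h6⟩ := hp
  refine ⟨⟨Ω.gauge w g, h1.congr (gauge_inside w _) (gauge_inside w g),
    (h2.smul w).congr (gauge_outside w _) (gauge_outside w g), ?_⟩,
    Tp, w • Tm, h4.gauge_inside w, h5.gauge_outside w, hT Tp Tm h6⟩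
  simp only [h3, map_add, map_smul, gauge_compLpL]

end SmoothDomain

lemma mem_graph_sandwich (U V : L2 →L[ℂ] L2) (T : L2 →ₗ.[ℂ] L2) (p : L2 × L2) :
    p ∈ (sandwich U T V).graph ↔ ∃ y, (V p.1, y) ∈ T.graph ∧ U y = p.2 := by
  obtain ⟨f, h⟩ := p
  simp only [LinearPMap.mem_graph_iff]
  constructor
  · rintro ⟨⟨y, hy⟩, rfl, rfl⟩
    exact ⟨T ⟨V y, hy⟩, ⟨⟨V y, hy⟩, rfl, rfl⟩, rfl⟩
  · rintro ⟨y, ⟨⟨a, ha⟩, hav, rfl⟩, rfl⟩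
    simp only at hav
    subst hav
    exact ⟨⟨f, ha⟩, rfl, rfl⟩

end DiracShell

end

open DiracShell
theorem theorem2p1 (Ω : SmoothDomain) (m : ℝ) (η τ lam : CInf ℝ Ω.shell) (ω d : ℝ)
    (hd : η ^ 2 - τ ^ 2 - lam ^ 2 = algebraMap ℝ (CInf ℝ Ω.shell) d)
    (X : ℂ) (hX : (d : ℂ) * X ^ 2 - 4 + (4 + (ω : ℂ) ^ 2 - d) * X = 0) :
    ∃ x : ℝ, x ≠ 0 ∧ X = (x : ℂ) ∧
      ‖gaugePhase d ω X‖ = 1 ∧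
      Ω.gauge (gaugePhase d ω X) ∈ unitary (L2 →L[ℂ] L2) ∧
      Ω.dirac m η τ lam (algebraMap ℝ (CInf ℝ Ω.shell) ω) =
        sandwich (Ω.gauge (gaugePhase d ω X))
          (Ω.dirac m (x • η) (x • τ) (x • lam) 0)
          (Ω.gauge (starRingEnd ℂ (gaugePhase d ω X))) := by
  obtain ⟨x, hx0, rfl, hq⟩ := exists_real_of_quadratic hX
  have hz := norm_gaugePhase hx0 hq
  have hzw := SmoothDomain.mul_conj_of_norm_eq_one hz
  have hT := SmoothDomain.trace_relation_iff hd hx0 hq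
  refine ⟨x, hx0, rfl, hz, SmoothDomain.gauge_mem_unitary hz, LinearPMap.eq_of_eq_graph ?_⟩
  ext p
  rw [mem_graph_sandwich, SmoothDomain.dirac_graph, SmoothDomain.dirac_graph]
  constructor
  · intro hp
    exact ⟨_, SmoothDomain.gauge_mem_diracGraph (fun Tp Tm => (hT Tp Tm).1) hp,
      SmoothDomain.gauge_gauge hzw _⟩
  · rintro ⟨y, hy, hyp⟩
    have h := SmoothDomain.gauge_mem_diracGraph (w := gaugePhase d ω x)
      (η' := η) (τ' := τ) (lam' := lam) (ω' := algebraMap ℝ (CInf ℝ Ω.shell) ω)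
      (fun Tp Tm h => (hT Tp _).2 (by rwa [smul_smul, mul_comm, hzw, one_smul])) hy
    simp only [SmoothDomain.gauge_gauge hzw, hyp] at h
    exact h
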